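/- Let $X$ be a real normed space, $C\subseteq X$ a bounded convex set with $\kappa=\operatorname{diam}(C)$, and $T:C\to C$ a nonexpansive map, i.e. $\|Tu-Tv\|\le\|u-v\|$ for all $u,v\in C$. Let $\alpha_n,\beta_n\in(0,1)$ for $n\ge 1$, let $x_0\in C$, and let $(x_n)_{n\ge 0}$ be generated by the Ishikawa iteration $$y_n=(1-\beta_{n+1})x_n+\beta_{n+1}Tx_n,\qquad x_{n+1}=(1-\alpha_{n+1})x_n+\alpha_{n+1}Ty_n\qquad(n\ge 0).$$ Put $\tau_n=\sum_{k=1}^n\alpha_k(1-\alpha_k)$ (so $\tau_0=0$) and $\sigma(y)=\min\{1,1/\sqrt{\pi y}\}$ for $y\ge 0$, with $\sigma(0)=1$. Assume that $\beta_n\to 0$, $\sum_{k\ge 1}\alpha_k\beta_k<\infty$ and $\sum_{k\ge 1}\alpha_k(1-\alpha_k)=\infty$. Then $\|x_n-Tx_n\|\to 0$ as $n\to\infty$, and for every $n\ge 0$ $$\|x_n-Tx_n\|\le\kappa\left[\sigma(\tau_n)+\sum_{i=1}^n\alpha_i\beta_i\,\sigma(\tau_n-\tau_i)+2\beta_{n+1}\right].$$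 -/

import Mathlib

open Filter Topology

noncomputable section

/-- The partial sums `τ_n = ∑_{k=1}^n α_k (1 - α_k)`. -/
def tau (α : ℕ → ℝ) (n : ℕ) : ℝ :=
  ∑ k ∈ Finset.Icc 1 n, α k * (1 - α k)

/-- The function `σ(y) = min {1, 1 / √(π y)}` for `y ≥ 0`. At `y = 0` the quotient is read
as `+∞`, so that `σ(0) = 1`; the case distinction is needed because `1 / 0 = 0` in Lean. -/
def sigma (y : ℝ) : ℝ :=
  if y = 0 then 1 else min 1 (1 / Real.sqrt (Real.pi * y))

/-- `x` (with the intermediate points `y`) is generated by the Ishikawa iteration of `T` with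
stepsizes `α_n`, `β_n` (`n ≥ 1`) from a starting point in `C`. -/
structure IsIshikawa {X : Type*} [NormedAddCommGroup X] [NormedSpace ℝ X]
    (C : Set X) (T : X → X) (α β : ℕ → ℝ) (x y : ℕ → X) : Prop where
  init : x 0 ∈ C
  inner_step : ∀ n : ℕ, y n = (1 - β (n + 1)) • x n + β (n + 1) • T (x n)
  outer_step : ∀ n : ℕ, x (n + 1) = (1 - α (n + 1)) • x n + α (n + 1) • T (y n)

end

/-! The distances `‖x m - T (x n)‖` are compared with a lazy walk on the nonnegative integers,
killed at 0, stepping each way with probability `p = α k * (1 - α k)`, while mass `α k * β k` is fed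
in at every positive position. Its value at position 1 and time `n`, times `κ`, bounds `‖x n - T (x
n)‖`.

For fixed `m`, `pursuit` advances `n`. Slots 0, 1, 2 carry norm bounds; higher slots are auxiliary,
since each step in `n` consults the next slot. Advancing `m` combines slots `r`, `r + 1`, `r + 2`.
Both steps are shift-invariant averages, so they commute, and one inequality at `n = m + 1`
(`one_level_le`) is enough to pass from `m` to `m + 1` (`pursuit_commute`). There the two averages
yield `1 - 2 * p` and `p` from `(1 - α) ^ 2 + α ^ 2` and `α * (1 - α)`; monotonicity in position
absorbs the terms involving `β`.

The walk is solved by Fourier integrals; at position 1 the bound `1 - s ≤ exp (-s)` and a Gaussian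
integral produce `sigma`. This gives the estimate even without the term `2 * β (n + 1)`. -/

/-! ### Fourier solution of the walk -/

/-- The kernel `sin (r θ) cot (θ / 2)`, written as a cosine polynomial. -/
noncomputable def ballotKernel (r : ℕ) (θ : ℝ) : ℝ :=
  ∑ i ∈ Finset.range r, (Real.cos (i * θ) + Real.cos ((i + 1 : ℕ) * θ))

/-- Fourier symbol of the survival function of the lazy walk with step probabilities
`α k * (1 - α k)`, fed at each level by `α k * β k`. -/
noncomputable def raceWeight (α β : ℕ → ℝ) : ℕ → ℝ → ℝ
  | 0, _ => 1
  | n + 1, θ => (1 - 2 * (α (n + 1) * (1 - α (n + 1))) * (1 - Real.cos θ)) * raceWeight α β n θ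
      + α (n + 1) * β (n + 1)

/-- Survival function, at position `r`, of the lazy walk killed at the origin, with feeding. -/
noncomputable def raceValue (α β : ℕ → ℝ) (n r : ℕ) : ℝ :=
  (1 / Real.pi) * ∫ θ in (0 : ℝ)..Real.pi, raceWeight α β n θ * ballotKernel r θ

theorem continuous_ballotKernel (r : ℕ) : Continuous (ballotKernel r) := by
  unfold ballotKernel; fun_prop

theorem continuous_raceWeight (α β : ℕ → ℝ) (n : ℕ) : Continuous (raceWeight α β n) := by
  induction n with
  | zero => exact continuous_const
  | succ n ih => simp only [raceWeight]; fun_prop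

theorem ballotKernel_one (θ : ℝ) : ballotKernel 1 θ = 1 + Real.cos θ := by
  simp [ballotKernel]

/-- Turns multiplication of the symbol by `2 * cos θ` into the nearest-neighbour sum in `r`. -/
theorem ballotKernel_recurrence (r : ℕ) (θ : ℝ) :
    ballotKernel (r + 2) θ + ballotKernel r θ = 2 * Real.cos θ * ballotKernel (r + 1) θ := by
  have key : ∀ i : ℕ, Real.cos ((i + 2 : ℕ) * θ) + Real.cos (i * θ)
      = 2 * Real.cos θ * Real.cos ((i + 1 : ℕ) * θ) := by
    intro i
    have h1 : ((i + 2 : ℕ) : ℝ) * θ = (i + 1 : ℕ) * θ + θ := by push_cast; ring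
    have h2 : (i : ℝ) * θ = (i + 1 : ℕ) * θ - θ := by push_cast; ring
    rw [h1, h2, Real.cos_add, Real.cos_sub]; ring
  induction r with
  | zero =>
    have h := key 0
    simp only [ballotKernel, Finset.sum_range_succ, Finset.sum_range_zero]
    norm_num at h ⊢
    nlinarith [h]
  | succ r ih =>
    have e : ∀ k : ℕ, ballotKernel (k + 1) θ
        = ballotKernel k θ + (Real.cos (k * θ) + Real.cos ((k + 1 : ℕ) * θ)) := fun k => by
      simp only [ballotKernel, Finset.sum_range_succ]
    rw [e (r + 2), e (r + 1)]
    have e1 := e r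
    have k1 := key r
    have k2 := key (r + 1)
    rw [e (r + 1)] at ih
    linear_combination ih + k1 + k2 + (1 : ℝ) * e1

theorem integral_cos_nat_mul (i : ℕ) (hi : i ≠ 0) :
    ∫ θ in (0 : ℝ)..Real.pi, Real.cos (i * θ) = 0 := by
  have h : (i : ℝ) ≠ 0 := by exact_mod_cast hi
  rw [intervalIntegral.integral_comp_mul_left _ h]
  simp [Real.sin_nat_mul_pi]

/-- Only the mode `i = 0` survives. Hence symbol 1 represents the constant 1 on positive positions,
as needed for the initial data and the feeding. -/
theorem integral_ballotKernel_succ (r : ℕ) :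
    ∫ θ in (0 : ℝ)..Real.pi, ballotKernel (r + 1) θ = Real.pi := by
  simp only [ballotKernel]
  rw [intervalIntegral.integral_finsetSum
    (fun i _ => Continuous.intervalIntegrable (by fun_prop) _ _), Finset.sum_range_succ']
  have h : ∀ i : ℕ, ∫ θ in (0 : ℝ)..Real.pi, (Real.cos (i * θ) + Real.cos ((i + 1 : ℕ) * θ))
      = ∫ θ in (0 : ℝ)..Real.pi, Real.cos (i * θ) := fun i => by
    rw [intervalIntegral.integral_add (Continuous.intervalIntegrable (by fun_prop) _ _)
      (Continuous.intervalIntegrable (by fun_prop) _ _), integral_cos_nat_mul (i + 1) (by omega),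
      add_zero]
  simp only [h]
  rw [Finset.sum_eq_zero fun i _ => integral_cos_nat_mul (i + 1) (by omega)]
  simp

theorem raceValue_zero_right (α β : ℕ → ℝ) (n : ℕ) : raceValue α β n 0 = 0 := by
  simp [raceValue, ballotKernel]

theorem raceValue_zero_succ (α β : ℕ → ℝ) (r : ℕ) : raceValue α β 0 (r + 1) = 1 := by
  simp only [raceValue, raceWeight, one_mul, integral_ballotKernel_succ]
  field_simp

theorem raceValue_succ_succ (α β : ℕ → ℝ) (n r : ℕ) :
    raceValue α β (n + 1) (r + 1)
      = (1 - 2 * (α (n + 1) * (1 - α (n + 1)))) * raceValue α β n (r + 1)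
        + α (n + 1) * (1 - α (n + 1)) * (raceValue α β n (r + 2) + raceValue α β n r)
        + α (n + 1) * β (n + 1) := by
  have hw := continuous_raceWeight α β n
  have hk := continuous_ballotKernel
  set p := α (n + 1) * (1 - α (n + 1)) with hp
  have e : ∀ θ, raceWeight α β (n + 1) θ * ballotKernel (r + 1) θ
      = (1 - 2 * p) * (raceWeight α β n θ * ballotKernel (r + 1) θ)
        + p * (raceWeight α β n θ * ballotKernel (r + 2) θ
          + raceWeight α β n θ * ballotKernel r θ)
        + α (n + 1) * β (n + 1) * ballotKernel (r + 1) θ := fun θ => by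
    have := ballotKernel_recurrence r θ
    simp only [raceWeight, ← hp]
    linear_combination -p * raceWeight α β n θ * this
  have i1 : ∀ q, IntervalIntegrable (fun θ => raceWeight α β n θ * ballotKernel q θ)
      MeasureTheory.volume 0 Real.pi := fun q => (hw.mul (hk q)).intervalIntegrable _ _
  have i2 : IntervalIntegrable (ballotKernel (r + 1)) MeasureTheory.volume 0 Real.pi :=
    (hk _).intervalIntegrable _ _
  simp only [raceValue, e]
  rw [intervalIntegral.integral_add (((i1 _).const_mul _).add (((i1 _).add (i1 _)).const_mul _))
    (i2.const_mul _), intervalIntegral.integral_add ((i1 _).const_mul _)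
    (((i1 _).add (i1 _)).const_mul _)]
  simp only [intervalIntegral.integral_const_mul]
  rw [intervalIntegral.integral_add (i1 _) (i1 _), integral_ballotKernel_succ]
  field_simp

/-- Since `p ≤ 1 / 4`, increments evolve with nonnegative weights; the feeding cancels in them
except at the origin, where it only helps. -/
theorem raceValue_monotone {α β : ℕ → ℝ} (hα : ∀ n : ℕ, 1 ≤ n → 0 < α n ∧ α n < 1)
    (hβ : ∀ n : ℕ, 1 ≤ n → 0 < β n ∧ β n < 1) (n : ℕ) : Monotone (raceValue α β n) := by
  induction n with
  | zero =>
    refine monotone_nat_of_le_succ fun r => ?_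
    cases r with
    | zero => simp [raceValue_zero_right, raceValue_zero_succ]
    | succ r => simp [raceValue_zero_succ]
  | succ n ih =>
    obtain ⟨a0, a1⟩ := hα (n + 1) (by omega)
    obtain ⟨b0, b1⟩ := hβ (n + 1) (by omega)
    have hp : 0 ≤ α (n + 1) * (1 - α (n + 1)) := mul_nonneg a0.le (by linarith)
    have hp' : 0 ≤ 1 - 2 * (α (n + 1) * (1 - α (n + 1))) := by
      nlinarith [sq_nonneg (α (n + 1) - 1 / 2)]
    have hs := fun k => sub_nonneg.2 (ih (Nat.le_succ k))
    refine monotone_nat_of_le_succ fun r => ?_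
    cases r with
    | zero =>
      have h1 : 0 ≤ raceValue α β n 1 := by simpa [raceValue_zero_right] using hs 0
      have h2 : 0 ≤ raceValue α β n 2 := h1.trans (ih (by omega))
      rw [raceValue_succ_succ, raceValue_zero_right, raceValue_zero_right]
      have := mul_nonneg a0.le b0.le
      have := mul_nonneg hp' h1
      have := mul_nonneg hp h2
      linarith
    | succ r =>
      rw [raceValue_succ_succ, raceValue_succ_succ]
      have := mul_nonneg hp' (hs (r + 1))
      have := mul_nonneg hp (hs (r + 2))
      have := mul_nonneg hp (hs r)
      simp only [Nat.succ_eq_add_one] at *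
      linarith

/-! ### Gaussian bound at position 1 -/

theorem integral_exp_neg_sq_le {t : ℝ} (ht : 0 < t) :
    ∫ u in (0 : ℝ)..1, Real.exp (-t * u ^ 2) ≤ Real.sqrt (Real.pi / t) / 2 := by
  rw [← integral_gaussian_Ioi t, intervalIntegral.integral_of_le zero_le_one]
  exact MeasureTheory.setIntegral_mono_set (integrable_exp_neg_mul_sq ht).integrableOn
    (Eventually.of_forall fun _ => (Real.exp_pos _).le)
    (Eventually.of_forall fun _ h => h.1)

theorem integral_exp_mul_one_add_cos_le_sigma {t : ℝ} (ht : 0 ≤ t) :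
    (1 / Real.pi) * ∫ θ in (0 : ℝ)..Real.pi,
      Real.exp (-(2 * t * (1 - Real.cos θ))) * (1 + Real.cos θ) ≤ sigma t := by
  have hpi := Real.pi_pos
  have h1 : (1 / Real.pi) * ∫ θ in (0 : ℝ)..Real.pi,
      Real.exp (-(2 * t * (1 - Real.cos θ))) * (1 + Real.cos θ) ≤ 1 := by
    have : ∫ θ in (0 : ℝ)..Real.pi,
        Real.exp (-(2 * t * (1 - Real.cos θ))) * (1 + Real.cos θ) ≤ Real.pi := by
      calc _ ≤ ∫ θ in (0 : ℝ)..Real.pi, (1 + Real.cos θ) := by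
            refine intervalIntegral.integral_mono_on hpi.le
              (Continuous.intervalIntegrable (by fun_prop) _ _)
              (Continuous.intervalIntegrable (by fun_prop) _ _) fun θ _ => ?_
            refine mul_le_of_le_one_left (by linarith [Real.neg_one_le_cos θ]) ?_
            rw [Real.exp_le_one_iff, neg_nonpos]
            exact mul_nonneg (by linarith) (by linarith [Real.cos_le_one θ])
        _ = Real.pi := by
            rw [intervalIntegral.integral_add (by simp) (by simp)]; simp
    rw [one_div, inv_mul_le_iff₀ hpi]; linarith
  unfold sigma
  split_ifs with h0
  · exact h1
  have ht' : 0 < t := lt_of_le_of_ne ht (Ne.symm h0)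
  refine le_min h1 ?_
  have h2 : ∫ θ in (0 : ℝ)..Real.pi,
      Real.exp (-(2 * t * (1 - Real.cos θ))) * (1 + Real.cos θ)
        ≤ 4 * ∫ u in (0 : ℝ)..1, Real.exp (-(4 * t) * u ^ 2) := by
    -- Substitute `u = sin (θ / 2)`: then `1 - cos θ = 2 * u ^ 2`, and `1 + cos θ = 2 * cos (θ / 2)
    -- ^ 2` is at most four times the Jacobian `cos (θ / 2) / 2`.
    have hsub : ∫ θ in (0 : ℝ)..Real.pi, ((fun u => Real.exp (-(4 * t) * u ^ 2)) ∘
        fun θ => Real.sin (θ / 2)) θ * (Real.cos (θ / 2) * (1 / 2))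
          = ∫ u in (0 : ℝ)..1, Real.exp (-(4 * t) * u ^ 2) := by
      have hd : ∀ θ ∈ Set.uIcc 0 Real.pi,
          HasDerivAt (fun θ => Real.sin (θ / 2)) (Real.cos (θ / 2) * (1 / 2)) θ := fun θ _ =>
        ((hasDerivAt_id' θ).div_const 2).sin
      rw [intervalIntegral.integral_comp_mul_deriv hd (by fun_prop) (by fun_prop)]
      simp
    rw [← hsub, ← intervalIntegral.integral_const_mul]
    refine intervalIntegral.integral_mono_on hpi.le
      (Continuous.intervalIntegrable (by fun_prop) _ _)
      (Continuous.intervalIntegrable (by fun_prop) _ _) fun θ hθ => ?_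
    have hc : Real.cos θ = 2 * Real.cos (θ / 2) ^ 2 - 1 := by
      rw [← Real.cos_two_mul]; congr 1; ring
    have hs := Real.sin_sq_add_cos_sq (θ / 2)
    have hc0 : 0 ≤ Real.cos (θ / 2) :=
      Real.cos_nonneg_of_mem_Icc ⟨by linarith [hθ.1], by linarith [hθ.2]⟩
    have hc1 := Real.cos_le_one (θ / 2)
    have he : -(2 * t * (1 - Real.cos θ)) = -(4 * t) * Real.sin (θ / 2) ^ 2 := by
      rw [hc]; linear_combination 4 * t * hs
    simp only [Function.comp_apply]
    rw [he, hc]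
    have := mul_le_mul_of_nonneg_left (show 1 + (2 * Real.cos (θ / 2) ^ 2 - 1)
      ≤ 2 * Real.cos (θ / 2) by nlinarith) (Real.exp_pos (-(4 * t) * Real.sin (θ / 2) ^ 2)).le
    linarith
  have h3 := integral_exp_neg_sq_le (t := 4 * t) (by linarith)
  have h4 : Real.sqrt (Real.pi / (4 * t)) = Real.sqrt (Real.pi / t) / 2 := by
    rw [show Real.pi / (4 * t) = (Real.pi / t) / 2 ^ 2 by field_simp; norm_num,
      Real.sqrt_div' _ (by norm_num), Real.sqrt_sq (by norm_num)]
  have h5 : 1 / Real.sqrt (Real.pi * t) = (1 / Real.pi) * Real.sqrt (Real.pi / t) := by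
    rw [Real.sqrt_mul hpi.le, Real.sqrt_div hpi.le]
    have a := Real.sqrt_pos.2 hpi
    have b := Real.sqrt_pos.2 ht'
    field_simp
    exact (Real.sq_sqrt hpi.le).symm
  rw [h5]
  refine mul_le_mul_of_nonneg_left ?_ (by positivity)
  linarith

theorem tau_succ (α : ℕ → ℝ) (n : ℕ) :
    tau α (n + 1) = tau α n + α (n + 1) * (1 - α (n + 1)) := by
  rw [tau, Finset.sum_Icc_succ_top (by omega), ← tau]

theorem tau_monotone {α : ℕ → ℝ} (hα : ∀ n : ℕ, 1 ≤ n → 0 < α n ∧ α n < 1) :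
    Monotone (tau α) := by
  refine monotone_nat_of_le_succ fun n => ?_
  obtain ⟨a0, a1⟩ := hα (n + 1) (by omega)
  rw [tau_succ]
  have := mul_pos a0 (sub_pos.2 a1)
  linarith

theorem raceWeight_le {α β : ℕ → ℝ} (hα : ∀ n : ℕ, 1 ≤ n → 0 < α n ∧ α n < 1)
    (hβ : ∀ n : ℕ, 1 ≤ n → 0 < β n ∧ β n < 1) (n : ℕ) (θ : ℝ) :
    raceWeight α β n θ ≤ Real.exp (-(2 * tau α n * (1 - Real.cos θ)))
      + ∑ i ∈ Finset.Icc 1 n,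
        α i * β i * Real.exp (-(2 * (tau α n - tau α i) * (1 - Real.cos θ))) := by
  induction n with
  | zero => simp [raceWeight, tau]
  | succ n ih =>
    obtain ⟨a0, a1⟩ := hα (n + 1) (by omega)
    have hc := Real.neg_one_le_cos θ
    have hc' := Real.cos_le_one θ
    set p := α (n + 1) * (1 - α (n + 1)) with hp
    have hp0 : 0 ≤ p := mul_nonneg a0.le (by linarith)
    -- Keeps the factor `1 - 2 * p * (1 - cos θ)` nonnegative even at `cos θ = -1`.
    have hp4 : p ≤ 1 / 4 := by nlinarith [sq_nonneg (α (n + 1) - 1 / 2)]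
    have hm0 : 0 ≤ 1 - 2 * p * (1 - Real.cos θ) := by nlinarith
    have hm : 1 - 2 * p * (1 - Real.cos θ) ≤ Real.exp (-(2 * p * (1 - Real.cos θ))) := by
      linarith [Real.add_one_le_exp (-(2 * p * (1 - Real.cos θ)))]
    have hexp : ∀ s : ℝ, Real.exp (-(2 * p * (1 - Real.cos θ)))
        * Real.exp (-(2 * s * (1 - Real.cos θ)))
          = Real.exp (-(2 * (s + p) * (1 - Real.cos θ))) := fun s => by
      rw [← Real.exp_add]; congr 1; ring
    have hnn : 0 ≤ Real.exp (-(2 * tau α n * (1 - Real.cos θ)))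
      + ∑ i ∈ Finset.Icc 1 n,
        α i * β i * Real.exp (-(2 * (tau α n - tau α i) * (1 - Real.cos θ))) := by
      refine add_nonneg (Real.exp_pos _).le (Finset.sum_nonneg fun i hi => ?_)
      have hi := (Finset.mem_Icc.1 hi).1
      exact mul_nonneg (mul_nonneg (hα i hi).1.le (hβ i hi).1.le) (Real.exp_pos _).le
    have h := (mul_le_mul_of_nonneg_left ih hm0).trans (mul_le_mul_of_nonneg_right hm hnn)
    rw [mul_add, hexp, ← tau_succ, Finset.mul_sum] at h
    rw [raceWeight, Finset.sum_Icc_succ_top (by omega), ← hp]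
    have hsum : ∑ i ∈ Finset.Icc 1 n, Real.exp (-(2 * p * (1 - Real.cos θ)))
        * (α i * β i * Real.exp (-(2 * (tau α n - tau α i) * (1 - Real.cos θ))))
          = ∑ i ∈ Finset.Icc 1 n,
            α i * β i * Real.exp (-(2 * (tau α (n + 1) - tau α i) * (1 - Real.cos θ))) := by
      refine Finset.sum_congr rfl fun i _ => ?_
      rw [mul_left_comm, hexp, tau_succ, ← hp]
      congr 4
      ring
    rw [hsum] at h
    simp only [sub_self, mul_zero, zero_mul, neg_zero, Real.exp_zero, mul_one]
    linarith

theorem raceValue_one_le {α β : ℕ → ℝ} (hα : ∀ n : ℕ, 1 ≤ n → 0 < α n ∧ α n < 1)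
    (hβ : ∀ n : ℕ, 1 ≤ n → 0 < β n ∧ β n < 1) (n : ℕ) :
    raceValue α β n 1 ≤ sigma (tau α n)
      + ∑ i ∈ Finset.Icc 1 n, α i * β i * sigma (tau α n - tau α i) := by
  have hpi := Real.pi_pos
  let J : ℝ → ℝ := fun t => (1 / Real.pi) * ∫ θ in (0 : ℝ)..Real.pi,
    Real.exp (-(2 * t * (1 - Real.cos θ))) * (1 + Real.cos θ)
  have hJ : raceValue α β n 1 ≤ J (tau α n)
      + ∑ i ∈ Finset.Icc 1 n, α i * β i * J (tau α n - tau α i) := by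
    have e : J (tau α n) + ∑ i ∈ Finset.Icc 1 n, α i * β i * J (tau α n - tau α i)
        = (1 / Real.pi) * ∫ θ in (0 : ℝ)..Real.pi,
          (Real.exp (-(2 * tau α n * (1 - Real.cos θ))) * (1 + Real.cos θ)
            + ∑ i ∈ Finset.Icc 1 n, α i * β i *
              (Real.exp (-(2 * (tau α n - tau α i) * (1 - Real.cos θ))) * (1 + Real.cos θ))) := by
      rw [intervalIntegral.integral_add (Continuous.intervalIntegrable (by fun_prop) _ _)
        (Continuous.intervalIntegrable (by fun_prop) _ _),
        intervalIntegral.integral_finsetSum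
          (fun i _ => Continuous.intervalIntegrable (by fun_prop) _ _), mul_add, Finset.mul_sum]
      simp only [intervalIntegral.integral_const_mul, J]
      congr 1
      exact Finset.sum_congr rfl fun i _ => mul_left_comm _ _ _
    rw [e, raceValue]
    refine mul_le_mul_of_nonneg_left ?_ (by positivity)
    refine intervalIntegral.integral_mono_on hpi.le
      (((continuous_raceWeight α β n).mul (continuous_ballotKernel 1)).intervalIntegrable _ _)
      (Continuous.intervalIntegrable (by fun_prop) _ _) fun θ _ => ?_
    have h := mul_le_mul_of_nonneg_right (raceWeight_le hα hβ n θ)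
      (show 0 ≤ 1 + Real.cos θ by linarith [Real.neg_one_le_cos θ])
    rw [ballotKernel_one]
    refine h.trans (le_of_eq ?_)
    rw [add_mul, Finset.sum_mul]
    congr 1
    exact Finset.sum_congr rfl fun i _ => mul_assoc _ _ _
  have hmono := tau_monotone hα
  refine hJ.trans (add_le_add (integral_exp_mul_one_add_cos_le_sigma ?_)
    (Finset.sum_le_sum fun i hi => ?_))
  · simpa [tau] using hmono (Nat.zero_le n)
  · have hi := Finset.mem_Icc.1 hi
    exact mul_le_mul_of_nonneg_left
      (integral_exp_mul_one_add_cos_le_sigma (sub_nonneg.2 (hmono hi.2)))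
      (mul_nonneg (hα i hi.1).1.le (hβ i hi.1).1.le)

/-! ### Exchanging the two time steps -/

/-- Starting from the profile `f` at time `m`, the bounds propagated to time `n ≥ m` when only
the later iterate moves. Slot `0` bounds `‖T (x m) - x n‖`, slot `1` bounds `‖x m - x n‖` and
slot `2` bounds `‖x m - T (x n)‖`. -/
noncomputable def pursuit (α β : ℕ → ℝ) (κ : ℝ) (m : ℕ) (f : ℕ → ℝ) : ℕ → ℕ → ℝ
  | 0 => f
  | n + 1 => if n + 1 ≤ m then f else fun q =>
      (1 - α (n + 1)) * pursuit α β κ m f n q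
        + α (n + 1) * ((1 - β (n + 1)) * pursuit α β κ m f n (q + 1) + β (n + 1) * κ)

theorem pursuit_self (α β : ℕ → ℝ) (κ : ℝ) (m : ℕ) (f : ℕ → ℝ) : pursuit α β κ m f m = f := by
  cases m <;> simp [pursuit]

theorem pursuit_succ (α β : ℕ → ℝ) (κ : ℝ) {m n : ℕ} (h : m ≤ n) (f : ℕ → ℝ) (q : ℕ) :
    pursuit α β κ m f (n + 1) q = (1 - α (n + 1)) * pursuit α β κ m f n q
      + α (n + 1) * ((1 - β (n + 1)) * pursuit α β κ m f n (q + 1) + β (n + 1) * κ) := by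
  rw [pursuit, if_neg (by omega)]

/-- The profile with `ρ` in slot `0` and the rescaled survival function above it. -/
noncomputable def raceProfile (α β : ℕ → ℝ) (κ ρ : ℝ) (m : ℕ) : ℕ → ℝ
  | 0 => ρ
  | q + 1 => κ * raceValue α β m q

theorem one_level_le {a b κ ρ : ℝ} (ha : 0 < a ∧ a < 1) (hb : 0 < b ∧ b < 1)
    {v f g : ℕ → ℝ} (hv0 : v 0 = 0) (hv : Monotone v) (hρ : ρ ≤ v 1)
    (hf0 : f 0 = ρ) (hf : ∀ q, f (q + 1) = v q)
    (hg : ∀ q, g q = (1 - a) * f q + a * ((1 - b) * f (q + 1) + b * κ)) (r : ℕ) :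
    (1 - a) * g (r + 2) + a * ((1 - b) * g (r + 1) + b * g r)
      ≤ (1 - 2 * (a * (1 - a))) * v (r + 1) + a * (1 - a) * (v (r + 2) + v r) + a * b * κ := by
  obtain ⟨a0, a1⟩ := ha
  obtain ⟨b0, b1⟩ := hb
  have hnn : ∀ q, 0 ≤ v q := fun q => hv0 ▸ hv (Nat.zero_le q)
  have hab := mul_pos a0 b0
  cases r with
  | zero =>
    have h12 : ρ ≤ v 2 := hρ.trans (hv (by omega))
    -- This is exactly the right side minus the left; the nonzero case below is analogous.
    have : 0 ≤ a * b * ((1 - a) * (v 2 - ρ) + a * v 1 * (2 - b)) :=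
      mul_nonneg hab.le (add_nonneg (mul_nonneg (by linarith) (by linarith))
        (mul_nonneg (mul_nonneg a0.le (hnn 1)) (by linarith)))
    simp only [hg, zero_add, hf0, hf, hv0]
    linarith
  | succ r =>
    have h1 := sub_nonneg.2 (hv (show r ≤ r + 1 by omega))
    have h2 := sub_nonneg.2 (hv (show r + 1 ≤ r + 2 by omega))
    have : 0 ≤ a * b * (((1 - a) * v (r + 3) + a * v (r + 2))
        + ((1 - a) * (v (r + 1) - v r) + a * ((1 - b) * (v (r + 2) - v (r + 1))))) :=
      mul_nonneg hab.le (add_nonneg (add_nonneg (mul_nonneg (by linarith) (hnn _))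
        (mul_nonneg a0.le (hnn _))) (add_nonneg (mul_nonneg (by linarith) h1)
          (mul_nonneg a0.le (mul_nonneg (by linarith) h2))))
    simp only [hg, hf]
    linarith

/-- The weights on the left sum to 1, so the forcing `β * κ` passes through unchanged. The value
`ρ'` is free because slots from 2 upward never consult slot 0. -/
theorem pursuit_commute {α β : ℕ → ℝ} (hα : ∀ n : ℕ, 1 ≤ n → 0 < α n ∧ α n < 1)
    (hβ : ∀ n : ℕ, 1 ≤ n → 0 < β n ∧ β n < 1) {κ ρ ρ' : ℝ} (hκ : 0 ≤ κ) {m : ℕ}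
    (hρ : ρ ≤ κ * raceValue α β m 1) {n : ℕ} (hn : m + 1 ≤ n) (r : ℕ) :
    (1 - α (m + 1)) * pursuit α β κ m (raceProfile α β κ ρ m) n (r + 2)
      + α (m + 1) * ((1 - β (m + 1)) * pursuit α β κ m (raceProfile α β κ ρ m) n (r + 1)
        + β (m + 1) * pursuit α β κ m (raceProfile α β κ ρ m) n r)
      ≤ pursuit α β κ (m + 1) (raceProfile α β κ ρ' (m + 1)) n (r + 2) := by
  induction n, hn using Nat.le_induction generalizing r with
  | base =>
    rw [pursuit_self]
    refine (one_level_le (v := fun q => κ * raceValue α β m q) (f := raceProfile α β κ ρ m)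
      (κ := κ) (ρ := ρ) (hα _ (by omega)) (hβ _ (by omega)) (by simp [raceValue_zero_right])
      ((raceValue_monotone hα hβ m).const_mul hκ) hρ rfl (fun _ => rfl)
      (fun q => by rw [pursuit_succ _ _ _ le_rfl, pursuit_self]) r).trans (le_of_eq ?_)
    simp only [raceProfile]
    rw [raceValue_succ_succ]
    ring
  | succ n hn ih =>
    obtain ⟨a0, a1⟩ := hα (n + 1) (by omega)
    obtain ⟨b0, b1⟩ := hβ (n + 1) (by omega)
    simp only [pursuit_succ _ _ _ (show m ≤ n by omega), pursuit_succ _ _ _ hn]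
    have h1 := mul_le_mul_of_nonneg_left (ih r) (sub_nonneg.2 a1.le)
    have h2 := mul_le_mul_of_nonneg_left (ih (r + 1))
      (mul_nonneg a0.le (sub_nonneg.2 b1.le))
    simp only [show r + 1 + 2 = r + 2 + 1 by ring, show r + 1 + 1 = r + 2 by ring] at h2 ⊢
    linarith

/-! ### Norm estimates along the iteration -/

theorem norm_convexComb_sub_le {X : Type*} [NormedAddCommGroup X] [NormedSpace ℝ X] {t : ℝ}
    (h0 : 0 ≤ t) (h1 : t ≤ 1) (u v w : X) :
    ‖((1 - t) • u + t • v) - w‖ ≤ (1 - t) * ‖u - w‖ + t * ‖v - w‖ := by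
  have e : ((1 - t) • u + t • v) - w = (1 - t) • (u - w) + t • (v - w) := by module
  rw [e]
  refine (norm_add_le _ _).trans (le_of_eq ?_)
  rw [norm_smul, norm_smul, Real.norm_of_nonneg h0, Real.norm_of_nonneg (sub_nonneg.2 h1)]

theorem norm_sub_convexComb_le {X : Type*} [NormedAddCommGroup X] [NormedSpace ℝ X] {t : ℝ}
    (h0 : 0 ≤ t) (h1 : t ≤ 1) (u v w : X) :
    ‖w - ((1 - t) • u + t • v)‖ ≤ (1 - t) * ‖w - u‖ + t * ‖w - v‖ := by
  simpa only [norm_sub_rev] using norm_convexComb_sub_le h0 h1 u v w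

section Ishikawa

variable {X : Type*} [NormedAddCommGroup X] [NormedSpace ℝ X] {C : Set X} {T : X → X}
  {α β : ℕ → ℝ} {x y : ℕ → X}

theorem IsIshikawa.mem (hx : IsIshikawa C T α β x y) (hC : Convex ℝ C) (hTC : Set.MapsTo T C C)
    (hα : ∀ n : ℕ, 1 ≤ n → 0 < α n ∧ α n < 1) (hβ : ∀ n : ℕ, 1 ≤ n → 0 < β n ∧ β n < 1)
    (n : ℕ) : x n ∈ C ∧ y n ∈ C := by
  have hy : ∀ n, x n ∈ C → y n ∈ C := fun n h => by
    obtain ⟨b0, b1⟩ := hβ (n + 1) (by omega)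
    rw [hx.inner_step]
    exact hC h (hTC h) (by linarith) b0.le (by ring)
  induction n with
  | zero => exact ⟨hx.init, hy 0 hx.init⟩
  | succ n ih =>
    obtain ⟨a0, a1⟩ := hα (n + 1) (by omega)
    have h : x (n + 1) ∈ C := by
      rw [hx.outer_step]
      exact hC ih.1 (hTC ih.2) (by linarith) a0.le (by ring)
    exact ⟨h, hy _ h⟩

/-- Once the distances to the images `T (x n)` and `T (y n)` are controlled, the remaining two
slots follow by moving the later iterate. -/
theorem IsIshikawa.norm_le_pursuit_of_image (hx : IsIshikawa C T α β x y) (hC : Convex ℝ C)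
    (hTC : Set.MapsTo T C C) (hT : ∀ u ∈ C, ∀ v ∈ C, ‖T u - T v‖ ≤ ‖u - v‖)
    (hα : ∀ n : ℕ, 1 ≤ n → 0 < α n ∧ α n < 1) (hβ : ∀ n : ℕ, 1 ≤ n → 0 < β n ∧ β n < 1)
    {κ : ℝ} (hκ : ∀ u ∈ C, ∀ v ∈ C, ‖u - v‖ ≤ κ) {m : ℕ} {f : ℕ → ℝ}
    (hf0 : ‖T (x m) - x m‖ ≤ f 0) (hf1 : 0 ≤ f 1)
    (hE : ∀ n, m ≤ n → ‖x m - T (y n)‖ ≤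
      (1 - β (n + 1)) * pursuit α β κ m f n 2 + β (n + 1) * κ) {n : ℕ} (hn : m ≤ n) :
    ‖T (x m) - x n‖ ≤ pursuit α β κ m f n 0 ∧ ‖x m - x n‖ ≤ pursuit α β κ m f n 1 := by
  have hxC := fun n => (hx.mem hC hTC hα hβ n).1
  have hyC := fun n => (hx.mem hC hTC hα hβ n).2
  induction n, hn using Nat.le_induction with
  | base => rw [pursuit_self]; exact ⟨hf0, by simpa using hf1⟩
  | succ n hn ih =>
    obtain ⟨a0, a1⟩ := hα (n + 1) (by omega)
    obtain ⟨b0, b1⟩ := hβ (n + 1) (by omega)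
    have hxy : ‖x m - y n‖ ≤ (1 - β (n + 1)) * pursuit α β κ m f n 1 + β (n + 1) * κ := by
      rw [hx.inner_step]
      exact (norm_sub_convexComb_le b0.le b1.le _ _ _).trans
        (add_le_add (mul_le_mul_of_nonneg_left ih.2 (by linarith))
          (mul_le_mul_of_nonneg_left (hκ _ (hxC m) _ (hTC (hxC n))) b0.le))
    rw [pursuit_succ _ _ _ hn, pursuit_succ _ _ _ hn, hx.outer_step]
    exact ⟨(norm_sub_convexComb_le a0.le a1.le _ _ _).trans
        (add_le_add (mul_le_mul_of_nonneg_left ih.1 (by linarith))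
          (mul_le_mul_of_nonneg_left ((hT _ (hxC m) _ (hyC n)).trans hxy) a0.le)),
      (norm_sub_convexComb_le a0.le a1.le _ _ _).trans
        (add_le_add (mul_le_mul_of_nonneg_left ih.2 (by linarith))
          (mul_le_mul_of_nonneg_left (hE n hn) a0.le))⟩

/-- Induction on `m`: unfolding `x (m + 1)` exposes `T (y m)`, to which nonexpansiveness applies
against `T (x n)` and `T (y n)`. The bound on `‖x m - T (y n)‖` is carried separately since `x m`
itself is no image under `T`. -/
theorem IsIshikawa.norm_le_pursuit (hx : IsIshikawa C T α β x y) (hC : Convex ℝ C)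
    (hTC : Set.MapsTo T C C) (hT : ∀ u ∈ C, ∀ v ∈ C, ‖T u - T v‖ ≤ ‖u - v‖)
    (hα : ∀ n : ℕ, 1 ≤ n → 0 < α n ∧ α n < 1) (hβ : ∀ n : ℕ, 1 ≤ n → 0 < β n ∧ β n < 1)
    {κ : ℝ} (hκ : ∀ u ∈ C, ∀ v ∈ C, ‖u - v‖ ≤ κ) (m : ℕ) :
    ∀ n, m ≤ n →
      ‖T (x m) - x n‖ ≤ pursuit α β κ m (raceProfile α β κ ‖T (x m) - x m‖ m) n 0 ∧
      ‖x m - x n‖ ≤ pursuit α β κ m (raceProfile α β κ ‖T (x m) - x m‖ m) n 1 ∧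
      ‖x m - T (x n)‖ ≤ pursuit α β κ m (raceProfile α β κ ‖T (x m) - x m‖ m) n 2 ∧
      ‖x m - T (y n)‖ ≤
        (1 - β (n + 1)) * pursuit α β κ m (raceProfile α β κ ‖T (x m) - x m‖ m) n 2
          + β (n + 1) * κ := by
  have hxC := fun n => (hx.mem hC hTC hα hβ n).1
  have hyC := fun n => (hx.mem hC hTC hα hβ n).2
  have hκ0 : 0 ≤ κ := (norm_nonneg _).trans (hκ _ hx.init _ hx.init)
  have reduce : ∀ m, (∀ n, m ≤ n →
      ‖x m - T (x n)‖ ≤ pursuit α β κ m (raceProfile α β κ ‖T (x m) - x m‖ m) n 2 ∧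
      ‖x m - T (y n)‖ ≤
        (1 - β (n + 1)) * pursuit α β κ m (raceProfile α β κ ‖T (x m) - x m‖ m) n 2
          + β (n + 1) * κ) → ∀ n, m ≤ n →
      ‖T (x m) - x n‖ ≤ pursuit α β κ m (raceProfile α β κ ‖T (x m) - x m‖ m) n 0 ∧
      ‖x m - x n‖ ≤ pursuit α β κ m (raceProfile α β κ ‖T (x m) - x m‖ m) n 1 ∧
      ‖x m - T (x n)‖ ≤ pursuit α β κ m (raceProfile α β κ ‖T (x m) - x m‖ m) n 2 ∧
      ‖x m - T (y n)‖ ≤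
        (1 - β (n + 1)) * pursuit α β κ m (raceProfile α β κ ‖T (x m) - x m‖ m) n 2
          + β (n + 1) * κ := fun m h n hn => by
    have := hx.norm_le_pursuit_of_image hC hTC hT hα hβ hκ
      (f := raceProfile α β κ ‖T (x m) - x m‖ m) le_rfl
      (by simp [raceProfile, raceValue_zero_right]) (fun k hk => (h k hk).2) hn
    exact ⟨this.1, this.2, h n hn⟩
  induction m with
  | zero =>
    -- At `m = 0` the slots from 2 upward start at `κ`, a fixed value of the step in `n`, so the
    -- diameter bound suffices.
    have hG : ∀ n q, pursuit α β κ 0 (raceProfile α β κ ‖T (x 0) - x 0‖ 0) n (q + 2) = κ := by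
      intro n
      induction n with
      | zero => intro q; rw [pursuit_self]; simp [raceProfile, raceValue_zero_succ]
      | succ n ih =>
        intro q
        rw [pursuit_succ _ _ _ (Nat.zero_le n), ih, show q + 2 + 1 = q + 1 + 2 by ring, ih]
        ring
    refine reduce 0 fun n _ => ?_
    rw [hG n 0]
    exact ⟨hκ _ hx.init _ (hTC (hxC n)), (hκ _ hx.init _ (hTC (hyC n))).trans_eq (by ring)⟩
  | succ m ih =>
    obtain ⟨a0, a1⟩ := hα (m + 1) (by omega)
    obtain ⟨b0, b1⟩ := hβ (m + 1) (by omega)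
    -- The desired estimate at time `m` itself controls slot 0 in the passage to `m + 1`.
    have hρ : ‖T (x m) - x m‖ ≤ κ * raceValue α β m 1 := by
      have := (ih m le_rfl).2.2.1
      rwa [pursuit_self, norm_sub_rev] at this
    refine reduce (m + 1) fun n hn => ?_
    obtain ⟨iH, iD, iR, iE⟩ := ih n (by omega)
    obtain ⟨c0, c1⟩ := hβ (n + 1) (by omega)
    have hcomm := pursuit_commute hα hβ (ρ' := ‖T (x (m + 1)) - x (m + 1)‖) hκ0 hρ hn 0
    have hyx := (norm_convexComb_sub_le b0.le b1.le (x m) (T (x m)) (x n)).trans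
      (add_le_add (mul_le_mul_of_nonneg_left iD (by linarith))
        (mul_le_mul_of_nonneg_left iH b0.le))
    rw [← hx.inner_step] at hyx
    have hyy := (norm_sub_convexComb_le c0.le c1.le (x n) (T (x n)) (y m)).trans
      (add_le_add (mul_le_mul_of_nonneg_left hyx (by linarith))
        (mul_le_mul_of_nonneg_left (hκ _ (hyC m) _ (hTC (hxC n))) c0.le))
    rw [← hx.inner_step] at hyy
    rw [hx.outer_step m] at *
    constructor
    · refine ((norm_convexComb_sub_le a0.le a1.le _ _ _).trans
        (add_le_add (mul_le_mul_of_nonneg_left iR (by linarith))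
          (mul_le_mul_of_nonneg_left ((hT _ (hyC m) _ (hxC n)).trans hyx) a0.le))).trans hcomm
    · have h1 := (norm_convexComb_sub_le a0.le a1.le _ _ _).trans
        (add_le_add (mul_le_mul_of_nonneg_left iE (by linarith))
          (mul_le_mul_of_nonneg_left ((hT _ (hyC m) _ (hyC n)).trans hyy) a0.le))
      have h2 := mul_le_mul_of_nonneg_left hcomm (sub_nonneg.2 c1.le)
      refine h1.trans ?_
      simp only [zero_add] at h2
      linarith

theorem IsIshikawa.norm_sub_map_le (hx : IsIshikawa C T α β x y) (hC : Convex ℝ C)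
    (hTC : Set.MapsTo T C C) (hT : ∀ u ∈ C, ∀ v ∈ C, ‖T u - T v‖ ≤ ‖u - v‖)
    (hα : ∀ n : ℕ, 1 ≤ n → 0 < α n ∧ α n < 1) (hβ : ∀ n : ℕ, 1 ≤ n → 0 < β n ∧ β n < 1)
    {κ : ℝ} (hκ : ∀ u ∈ C, ∀ v ∈ C, ‖u - v‖ ≤ κ) (n : ℕ) :
    ‖x n - T (x n)‖ ≤ κ * (sigma (tau α n)
      + ∑ i ∈ Finset.Icc 1 n, α i * β i * sigma (tau α n - tau α i)) := by
  have hκ0 : 0 ≤ κ := (norm_nonneg _).trans (hκ _ hx.init _ hx.init)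
  have h := (hx.norm_le_pursuit hC hTC hT hα hβ hκ n n le_rfl).2.2.1
  rw [pursuit_self] at h
  exact h.trans (mul_le_mul_of_nonneg_left (raceValue_one_le hα hβ n) hκ0)

end Ishikawa

/-! ### Passage to the limit -/

theorem sigma_nonneg (t : ℝ) : 0 ≤ sigma t := by
  unfold sigma
  split_ifs
  · exact zero_le_one
  · exact le_min zero_le_one (by positivity)

theorem sigma_le_one (t : ℝ) : sigma t ≤ 1 := by
  unfold sigma
  split_ifs
  · exact le_rfl
  · exact min_le_left _ _

theorem tendsto_sigma_atTop : Tendsto sigma atTop (𝓝 0) := by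
  have h : Tendsto (fun t : ℝ => 1 / Real.sqrt (Real.pi * t)) atTop (𝓝 0) :=
    (Real.tendsto_sqrt_atTop.comp (tendsto_id.const_mul_atTop Real.pi_pos)).const_div_atTop 1
  refine tendsto_of_tendsto_of_tendsto_of_le_of_le' tendsto_const_nhds h
    (Eventually.of_forall sigma_nonneg) ?_
  filter_upwards [eventually_gt_atTop 0] with t ht
  rw [sigma, if_neg ht.ne']
  exact min_le_right _ _

/-- Dominated convergence for series: each fixed term vanishes as `t n` grows, and `sigma ≤ 1` makes
`a` a summable majorant. -/
theorem tendsto_sum_mul_sigma {a t : ℕ → ℝ} (ha : ∀ k, 0 ≤ a (k + 1))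
    (hs : Summable fun k => a (k + 1)) (ht : Tendsto t atTop atTop) :
    Tendsto (fun n => ∑ i ∈ Finset.Icc 1 n, a i * sigma (t n - t i)) atTop (𝓝 0) := by
  have h := tendsto_tsum_of_dominated_convergence
    (f := fun n k => if k < n then a (k + 1) * sigma (t n - t (k + 1)) else 0)
    (g := fun _ => (0 : ℝ)) (𝓕 := atTop) hs (fun k => ?_) (Eventually.of_forall fun n k => ?_)
  · rw [tsum_zero] at h
    refine h.congr fun n => ?_
    rw [tsum_eq_sum (s := Finset.range n) fun k hk => if_neg (by simpa using hk),
      Finset.sum_congr rfl fun k hk => if_pos (Finset.mem_range.1 hk), Finset.range_eq_Ico,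
      Finset.sum_Ico_add' (fun i => a i * sigma (t n - t i)) 0 n 1]
    rfl
  · have h1 := (tendsto_sigma_atTop.comp
      (tendsto_atTop_add_const_right atTop (-t (k + 1)) ht)).const_mul (a (k + 1))
    rw [mul_zero] at h1
    refine h1.congr' ?_
    filter_upwards [eventually_gt_atTop k] with n hn
    rw [if_pos hn]
    rfl
  · split_ifs
    · rw [Real.norm_of_nonneg (mul_nonneg (ha k) (sigma_nonneg _))]
      exact mul_le_of_le_one_right (ha k) (sigma_le_one _)
    · simpa using ha k

theorem mainTheorem6 {X : Type*} [NormedAddCommGroup X] [NormedSpace ℝ X]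
    (C : Set X) (hCconv : Convex ℝ C) (hCbdd : Bornology.IsBounded C)
    (T : X → X) (hTC : Set.MapsTo T C C)
    (hT : ∀ u ∈ C, ∀ v ∈ C, ‖T u - T v‖ ≤ ‖u - v‖)
    (α β : ℕ → ℝ)
    (hα : ∀ n : ℕ, 1 ≤ n → 0 < α n ∧ α n < 1)
    (hβ : ∀ n : ℕ, 1 ≤ n → 0 < β n ∧ β n < 1)
    (x y : ℕ → X) (hx : IsIshikawa C T α β x y)
    (hβ0 : Tendsto β atTop (𝓝 0))
    (hαβ : Summable (fun k : ℕ => α (k + 1) * β (k + 1)))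
    (hτ : Tendsto (tau α) atTop atTop) :
    Tendsto (fun n : ℕ => ‖x n - T (x n)‖) atTop (𝓝 0) ∧
    ∀ n : ℕ, ‖x n - T (x n)‖ ≤
      Metric.diam C *
        (sigma (tau α n)
          + ∑ i ∈ Finset.Icc 1 n, α i * β i * sigma (tau α n - tau α i)
          + 2 * β (n + 1)) := by
  have hκ : ∀ u ∈ C, ∀ v ∈ C, ‖u - v‖ ≤ Metric.diam C := fun u hu v hv => by
    rw [← dist_eq_norm]
    exact Metric.dist_le_diam_of_mem hCbdd hu hv
  have hbound := fun n => hx.norm_sub_map_le hCconv hTC hT hα hβ hκ n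
  refine ⟨?_, fun n => (hbound n).trans (mul_le_mul_of_nonneg_left ?_ Metric.diam_nonneg)⟩
  · have hlim := ((tendsto_sigma_atTop.comp hτ).add (tendsto_sum_mul_sigma
      (a := fun k => α k * β k) (fun k => mul_nonneg (hα _ (by omega)).1.le
        (hβ _ (by omega)).1.le) hαβ hτ)).const_mul (Metric.diam C)
    rw [add_zero, mul_zero] at hlim
    exact squeeze_zero (fun _ => norm_nonneg _) hbound hlim
  · have := (hβ (n + 1) (by omega)).1
    linarith
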